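/- Let $\Gamma$ be a finite, compact metric graph (not necessarily connected; multiple edges are allowed) with edges $e_n=[x_{2n-1},x_{2n}]$, $x_{2n-1}<x_{2n}$, $n=1,\dots,E$, whose vertices are the classes of a partition of the set of endpoints $\{x_1,\dots,x_{2E}\}$. Assume that $\Gamma$ is bipartite, with vertex set the disjoint union of $\mathcal V_1$ and $\mathcal V_2$, and that every edge is oriented from $\mathcal V_1$ to $\mathcal V_2$, i.e. each left endpoint $x_{2n-1}$ belongs to a vertex in $\mathcal V_1$ and each right endpoint $x_{2n}$ to a vertex in $\mathcal V_2$. Let $L^2(\Gamma)=\bigoplus_{n=1}^E L^2(e_n)$ (complex-valued functions), and let $W^k_2(\Gamma\setminus\mathcal V)$ be the space of $f\in L^2(\Gamma)$ whose weak derivatives up to order $k$ inside every edge exist and lie in $L^2(\Gamma)$. For an endpoint $x_j$ write $f(x_j)$ for the limit of $f$ at $x_j$ from inside the edge, and $\partial f(x_j)=f'(x_j)$ if $x_j$ is a left endpoint, $\partial f(x_j)=-f'(x_j)$ if $x_j$ is a right endpoint. Define the following operators in $L^2(\Gamma)$. - The standard Laplacian $L^{\rm st}(\Gamma)$: $f\mapsto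 -f''$ on all $f\in W_2^2(\Gamma\setminus\mathcal V)$ such that at each vertex $v$ one has $f(x_i)=f(x_j)$ for all $x_i,x_j\in v$ and $\sum_{x_j\in v}\partial f(x_j)=0$. - The anti-standard Laplacian $L^{\rm a/st}(\Gamma)$: $f\mapsto -f''$ on all $f\in W_2^2(\Gamma\setminus\mathcal V)$ such that at each vertex $v$ one has $\sum_{x_j\in v}f(x_j)=0$ and $\partial f(x_i)=\partial f(x_j)$ for all $x_i,x_j\in v$. - The momentum operator $D$: $f\mapsto \frac1i f'$ on all $f\in W_2^1(\Gamma\setminus\mathcal V)$ such that $f(x_i)=f(x_j)$ whenever $x_i,x_j$ belong to the same vertex. Then $D$ is densely defined and, with $D^*$ its Hilbert space adjoint and with products of operators taken on their natural domains, $$L^{\rm st}(\Gamma)=D^*D\qquad\text{and}\qquad L^{\rm a/st}(\Gamma)=DD^*.$$ In particular, the positive eigenvalues of $L^{\rm st}(\Gamma)$ and $L^{\rm a/st}(\Gamma)$ coincide including multiplicities: for every real $\mu>0$, $\mu$ is an eigenvalue of one operator if and only if it is an eigenvalue of the other, and $\dim\ker(L^{\rm st}(\Gamma)-\mu)=\dim\ker(L^{\rm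 a/st}(\Gamma)-\mu)$. -/

import Mathlib

open MeasureTheory Filter Topology
open scoped ContDiff InnerProductSpace

noncomputable section

namespace UnboundedOperator

variable {H : Type*} [AddCommGroup H] [Module ℂ H]

/-- The product `S T` of two unbounded operators, with its natural domain
`{x ∈ dom T | T x ∈ dom S}`. -/
def prod (S T : H →ₗ.[ℂ] H) : H →ₗ.[ℂ] H where
  domain := (S.domain.comap T.toFun).map T.domain.subtype
  toFun :=
    { toFun := fun x => S ⟨T ⟨x, Submodule.map_subtype_le _ _ x.2⟩, by
        obtain ⟨y, hy, hyx⟩ := x.2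
        have : (⟨x, Submodule.map_subtype_le _ _ x.2⟩ : T.domain) = y := Subtype.ext hyx.symm
        rw [this]; exact hy⟩
      map_add' := fun x y => by
        rw [← S.map_add]
        congr 1
        exact Subtype.ext (T.map_add ⟨x, Submodule.map_subtype_le _ _ x.2⟩
          ⟨y, Submodule.map_subtype_le _ _ y.2⟩)
      map_smul' := fun c x => by
        rw [RingHom.id_apply, ← S.map_smul]
        congr 1
        exact Subtype.ext (T.map_smul c ⟨x, Submodule.map_subtype_le _ _ x.2⟩) }

/-- The eigenspace `ker (T - μ)` of an unbounded operator. -/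
def eigenspace (T : H →ₗ.[ℂ] H) (μ : ℂ) : Submodule ℂ H :=
  (LinearMap.ker (T.toFun - μ • T.domain.subtype)).map T.domain.subtype

/-- `μ` is an eigenvalue of `T`. -/
def IsEigenvalue (T : H →ₗ.[ℂ] H) (μ : ℂ) : Prop :=
  ∃ x : T.domain, (x : H) ≠ 0 ∧ T x = μ • (x : H)

/-- The multiplicity of `μ` as an eigenvalue of `T`: the dimension of `ker (T - μ)`. -/
def multiplicity (T : H →ₗ.[ℂ] H) (μ : ℂ) : Cardinal := Module.rank ℂ (eigenspace T μ)

end UnboundedOperator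

/-- A compact metric graph: every edge `e` is a non-degenerate interval `[left e, right e]`.
The endpoint `(e, false)` is the left endpoint of `e`, the endpoint `(e, true)` the right one.
Vertices are the classes of a partition of the set of endpoints, here given by the surjection
`vertex` that sends an endpoint to its class. Loops, multiple edges and several connected
components are allowed. The graph is finite when `E` is. -/
structure MetricGraph (V E : Type*) where
  left : E → ℝ
  right : E → ℝ
  left_lt_right : ∀ e, left e < right e
  vertex : E × Bool → V
  vertex_surjective : Function.Surjective vertex

namespace MetricGraph

variable {V E : Type*} (Γ : MetricGraph V E)

/-- `V₁`, `V₂` is a bipartition of the vertex set and every edge is oriented from `V₁` to `V₂`: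
its left endpoint lies in a vertex from `V₁`, its right endpoint in a vertex from `V₂`. -/
structure IsBipartiteOriented (V₁ V₂ : Set V) : Prop where
  disjoint : Disjoint V₁ V₂
  union_eq : V₁ ∪ V₂ = Set.univ
  left_mem : ∀ e, Γ.vertex (e, false) ∈ V₁
  right_mem : ∀ e, Γ.vertex (e, true) ∈ V₂

/-- The position of an endpoint on the real line. -/
def point (j : E × Bool) : ℝ := if j.2 then Γ.right j.1 else Γ.left j.1

/-- Lebesgue measure on the edge `e`. -/
def edgeMeasure (e : E) : Measure ℝ := volume.restrict (Set.Icc (Γ.left e) (Γ.right e))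

instance (e : E) : IsFiniteMeasure (Γ.edgeMeasure e) := by
  unfold edgeMeasure; infer_instance

/-- The Hilbert space `L₂(Γ) = ⨁ₑ L₂(e)` of complex-valued functions. -/
abbrev L2 : Type _ := PiLp 2 (fun e : E => Lp ℂ 2 (Γ.edgeMeasure e))

/-- `g` is the weak derivative of `f` inside every edge. -/
def HasWeakDeriv (f g : Γ.L2) : Prop :=
  ∀ (e : E) (φ : ℝ → ℝ), ContDiff ℝ ∞ φ → HasCompactSupport φ →
    tsupport φ ⊆ Set.Ioo (Γ.left e) (Γ.right e) →
    ∫ x, deriv φ x • f e x ∂(Γ.edgeMeasure e) = - ∫ x, φ x • g e x ∂(Γ.edgeMeasure e)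

variable {Γ}

lemma integrable_smul_edge (e : E) (u : Lp ℂ 2 (Γ.edgeMeasure e)) {φ : ℝ → ℝ}
    (hφ : Continuous φ) (hc : HasCompactSupport φ) :
    Integrable (fun x => φ x • u x) (Γ.edgeMeasure e) := by
  obtain ⟨C, hC⟩ := hc.exists_bound_of_continuous hφ
  have hu : Integrable u (Γ.edgeMeasure e) := (Lp.memLp u).integrable (by norm_num)
  exact hu.bdd_smul C hφ.aestronglyMeasurable (Eventually.of_forall hC)

lemma HasWeakDeriv.add {f f' g g' : Γ.L2} (hf : Γ.HasWeakDeriv f f')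
    (hg : Γ.HasWeakDeriv g g') : Γ.HasWeakDeriv (f + g) (f' + g') := by
  intro e φ hφ hc hs
  have hd : Continuous (deriv φ) := hφ.continuous_deriv (by simp)
  have key : ∀ (u v : Lp ℂ 2 (Γ.edgeMeasure e)) (ψ : ℝ → ℝ), Continuous ψ →
      HasCompactSupport ψ → ∫ x, ψ x • (u + v) x ∂(Γ.edgeMeasure e) =
        ∫ x, ψ x • u x ∂(Γ.edgeMeasure e) + ∫ x, ψ x • v x ∂(Γ.edgeMeasure e) := by
    intro u v ψ hψ hψc
    rw [← integral_add (integrable_smul_edge e u hψ hψc) (integrable_smul_edge e v hψ hψc)]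
    apply integral_congr_ae
    filter_upwards [Lp.coeFn_add u v] with x hx
    rw [hx, Pi.add_apply, smul_add]
  rw [PiLp.add_apply, PiLp.add_apply, key _ _ _ hd hc.deriv, key _ _ _ hφ.continuous hc,
    hf e φ hφ hc hs, hg e φ hφ hc hs]
  ring

lemma HasWeakDeriv.smul {f f' : Γ.L2} (c : ℂ) (hf : Γ.HasWeakDeriv f f') :
    Γ.HasWeakDeriv (c • f) (c • f') := by
  intro e φ hφ hc hs
  have key : ∀ (u : Lp ℂ 2 (Γ.edgeMeasure e)) (ψ : ℝ → ℝ),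
      ∫ x, ψ x • (c • u) x ∂(Γ.edgeMeasure e) = c • ∫ x, ψ x • u x ∂(Γ.edgeMeasure e) := by
    intro u ψ
    rw [← integral_smul]
    apply integral_congr_ae
    filter_upwards [Lp.coeFn_smul c u] with x hx
    rw [hx, Pi.smul_apply, smul_comm]
  rw [PiLp.smul_apply, PiLp.smul_apply, key, key, hf e φ hφ hc hs, smul_neg]

lemma HasWeakDeriv.zero : Γ.HasWeakDeriv 0 0 := by
  intro e φ _ _ _
  have h0 : ∀ ψ : ℝ → ℝ,
      ∫ x, ψ x • (0 : Lp ℂ 2 (Γ.edgeMeasure e)) x ∂(Γ.edgeMeasure e) = 0 := by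
    intro ψ
    apply integral_eq_zero_of_ae
    filter_upwards [Lp.coeFn_zero ℂ 2 (Γ.edgeMeasure e)] with x hx
    rw [hx]; simp
  rw [PiLp.zero_apply, h0, h0, neg_zero]

/-- Weak derivatives are unique. -/
lemma HasWeakDeriv.unique {f g h : Γ.L2} (hg : Γ.HasWeakDeriv f g)
    (hh : Γ.HasWeakDeriv f h) : g = h := by
  ext1 e
  apply Lp.ext
  have hgi : Integrable (g e) (Γ.edgeMeasure e) := (Lp.memLp (g e)).integrable (by norm_num)
  have hhi : Integrable (h e) (Γ.edgeMeasure e) := (Lp.memLp (h e)).integrable (by norm_num)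
  have hI : LocallyIntegrableOn (fun x => g e x - h e x)
      (Set.Ioo (Γ.left e) (Γ.right e)) volume :=
    (IntegrableOn.mono_set (hgi.sub hhi) Set.Ioo_subset_Icc_self).locallyIntegrableOn
  have hz := isOpen_Ioo.ae_eq_zero_of_integral_contDiff_smul_eq_zero hI (by
    intro φ hφ hc hs
    have h1 := (hg e φ hφ hc hs).symm.trans (hh e φ hφ hc hs)
    have h2 : ∫ x, φ x • (g e x - h e x) ∂(Γ.edgeMeasure e) = 0 := by
      simp_rw [smul_sub]
      rw [integral_sub (integrable_smul_edge e _ hφ.continuous hc)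
        (integrable_smul_edge e _ hφ.continuous hc), neg_inj.mp h1, sub_self]
    rw [← h2]
    refine (setIntegral_eq_integral_of_forall_compl_eq_zero ?_).symm
    intro x hx
    have : x ∉ tsupport φ := fun hx' => hx (Set.Ioo_subset_Icc_self (hs hx'))
    rw [image_eq_zero_of_notMem_tsupport this, zero_smul])
  change ∀ᵐ x ∂(volume.restrict (Set.Icc (Γ.left e) (Γ.right e))), g e x = h e x
  rw [← Measure.restrict_congr_set Ioo_ae_eq_Icc, ae_restrict_iff' measurableSet_Ioo]
  filter_upwards [hz] with x hx hxm
  exact sub_eq_zero.mp (hx hxm)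

variable (Γ)

/-- The Sobolev space `W₂¹(Γ \ V)`. -/
def W1 : Submodule ℂ Γ.L2 where
  carrier := {f | ∃ g, Γ.HasWeakDeriv f g}
  zero_mem' := ⟨0, HasWeakDeriv.zero⟩
  add_mem' := fun ⟨_, hf⟩ ⟨_, hg⟩ => ⟨_, hf.add hg⟩
  smul_mem' := fun c _ ⟨_, hf⟩ => ⟨_, hf.smul c⟩

/-- The weak derivative `f ↦ f'` on `W₂¹(Γ \ V)`. -/
def weakDeriv : Γ.W1 →ₗ[ℂ] Γ.L2 where
  toFun f := f.2.choose
  map_add' f g := (f + g).2.choose_spec.unique (f.2.choose_spec.add g.2.choose_spec)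
  map_smul' c f := (c • f).2.choose_spec.unique (f.2.choose_spec.smul c)

lemma hasWeakDeriv_weakDeriv (f : Γ.W1) : Γ.HasWeakDeriv f (Γ.weakDeriv f) :=
  f.2.choose_spec

/-- The numbers `t j` are the limiting values of `f` at the endpoints: `f(x)` tends to `t j` as
`x` approaches the endpoint `j` inside its edge. As `f` is an almost everywhere class, null sets
are disregarded; this is the limit of the continuous representative whenever there is one. -/
def HasBoundaryValues (f : Γ.L2) (t : E × Bool → ℂ) : Prop :=
  ∀ j : E × Bool, Tendsto (f j.1) (𝓝 (Γ.point j) ⊓ ae (Γ.edgeMeasure j.1)) (𝓝 (t j))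

/-- Continuity condition at each vertex, for a family of values at the endpoints. -/
def IsContinuousAtVertices (t : E × Bool → ℂ) : Prop :=
  ∀ i j, Γ.vertex i = Γ.vertex j → t i = t j

open Classical in
/-- Balance condition at each vertex, for a family of values at the endpoints. -/
def IsBalancedAtVertices [Fintype E] (t : E × Bool → ℂ) : Prop :=
  ∀ v, ∑ j with Γ.vertex j = v, t j = 0

/-- Turns the values `f'(xⱼ)` into the derivatives `∂f(xⱼ)` in the direction from the vertex into
the edge. -/
def inward (t : E × Bool → ℂ) : E × Bool → ℂ := fun j => if j.2 then - t j else t j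

variable {Γ}

lemma HasBoundaryValues.zero : Γ.HasBoundaryValues 0 0 := by
  intro j
  refine Tendsto.congr' ?_ tendsto_const_nhds
  have h : ((0 : Lp ℂ 2 (Γ.edgeMeasure j.1)) : ℝ → ℂ) =ᵐ[Γ.edgeMeasure j.1] 0 :=
    Lp.coeFn_zero ℂ 2 _
  exact (h.filter_mono inf_le_right).symm

lemma HasBoundaryValues.add {f g : Γ.L2} {s t : E × Bool → ℂ}
    (hf : Γ.HasBoundaryValues f s) (hg : Γ.HasBoundaryValues g t) :
    Γ.HasBoundaryValues (f + g) (s + t) := by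
  intro j
  refine Tendsto.congr' ?_ ((hf j).add (hg j))
  exact ((Lp.coeFn_add (f j.1) (g j.1)).filter_mono inf_le_right).symm

lemma HasBoundaryValues.smul {f : Γ.L2} {s : E × Bool → ℂ} (c : ℂ)
    (hf : Γ.HasBoundaryValues f s) : Γ.HasBoundaryValues (c • f) (c • s) := by
  intro j
  refine Tendsto.congr' ?_ ((hf j).const_smul c)
  exact ((Lp.coeFn_smul c (f j.1)).filter_mono inf_le_right).symm

lemma IsContinuousAtVertices.add {s t : E × Bool → ℂ} (hs : Γ.IsContinuousAtVertices s)
    (ht : Γ.IsContinuousAtVertices t) : Γ.IsContinuousAtVertices (s + t) := fun i j h => by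
  simp [hs i j h, ht i j h]

lemma IsContinuousAtVertices.smul {s : E × Bool → ℂ} (c : ℂ)
    (hs : Γ.IsContinuousAtVertices s) : Γ.IsContinuousAtVertices (c • s) := fun i j h => by
  simp [hs i j h]

lemma IsContinuousAtVertices.zero : Γ.IsContinuousAtVertices 0 := fun _ _ _ => rfl

lemma IsBalancedAtVertices.add [Fintype E] {s t : E × Bool → ℂ}
    (hs : Γ.IsBalancedAtVertices s) (ht : Γ.IsBalancedAtVertices t) :
    Γ.IsBalancedAtVertices (s + t) := fun v => by
  simp [Finset.sum_add_distrib, hs v, ht v]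

lemma IsBalancedAtVertices.smul [Fintype E] {s : E × Bool → ℂ} (c : ℂ)
    (hs : Γ.IsBalancedAtVertices s) : Γ.IsBalancedAtVertices (c • s) := fun v => by
  simp [← Finset.mul_sum, hs v]

lemma IsBalancedAtVertices.zero [Fintype E] : Γ.IsBalancedAtVertices 0 := fun v => by simp

lemma inward_add (s t : E × Bool → ℂ) : inward (s + t) = inward s + inward t := by
  funext j; by_cases h : j.2 <;> simp [inward, h, add_comm]

lemma inward_smul (c : ℂ) (s : E × Bool → ℂ) : inward (c • s) = c • inward s := by
  funext j; by_cases h : j.2 <;> simp [inward, h]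

lemma inward_zero : inward (0 : E × Bool → ℂ) = 0 := by
  funext j; simp [inward]

variable (Γ)

/-- The weak derivative as an unbounded operator in `L₂(Γ)` with domain `W₂¹(Γ \ V)`. -/
def ddx : Γ.L2 →ₗ.[ℂ] Γ.L2 := ⟨Γ.W1, Γ.weakDeriv⟩

/-- The second weak derivative `f ↦ (f')'`. Its domain is the Sobolev space `W₂²(Γ \ V)` of all
`f ∈ W₂¹(Γ \ V)` with `f' ∈ W₂¹(Γ \ V)`. -/
def ddx₂ : Γ.L2 →ₗ.[ℂ] Γ.L2 := UnboundedOperator.prod Γ.ddx Γ.ddx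

/-- The Sobolev space `W₂²(Γ \ V)`. -/
def W2 : Submodule ℂ Γ.L2 := Γ.ddx₂.domain

/-- Functions whose limiting values `f(xⱼ)` exist and satisfy the continuity condition. -/
def continuousValues : Submodule ℂ Γ.L2 where
  carrier := {f | ∃ t, Γ.HasBoundaryValues f t ∧ Γ.IsContinuousAtVertices t}
  zero_mem' := ⟨0, .zero, .zero⟩
  add_mem' := fun ⟨_, hf, hs⟩ ⟨_, hg, ht⟩ => ⟨_, hf.add hg, hs.add ht⟩
  smul_mem' := fun c _ ⟨_, hf, hs⟩ => ⟨_, hf.smul c, hs.smul c⟩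

/-- Functions whose limiting values `f(xⱼ)` exist and satisfy the balance condition. -/
def balancedValues [Fintype E] : Submodule ℂ Γ.L2 where
  carrier := {f | ∃ t, Γ.HasBoundaryValues f t ∧ Γ.IsBalancedAtVertices t}
  zero_mem' := ⟨0, .zero, .zero⟩
  add_mem' := fun ⟨_, hf, hs⟩ ⟨_, hg, ht⟩ => ⟨_, hf.add hg, hs.add ht⟩
  smul_mem' := fun c _ ⟨_, hf, hs⟩ => ⟨_, hf.smul c, hs.smul c⟩

/-- Functions `f'` for which the values `∂f(xⱼ)` exist and satisfy the continuity condition. -/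
def continuousInward : Submodule ℂ Γ.L2 where
  carrier := {f' | ∃ t, Γ.HasBoundaryValues f' t ∧ Γ.IsContinuousAtVertices (inward t)}
  zero_mem' := ⟨0, .zero, by rw [inward_zero]; exact .zero⟩
  add_mem' := fun ⟨_, hf, hs⟩ ⟨_, hg, ht⟩ =>
    ⟨_, hf.add hg, by rw [inward_add]; exact hs.add ht⟩
  smul_mem' := fun c _ ⟨_, hf, hs⟩ => ⟨_, hf.smul c, by rw [inward_smul]; exact hs.smul c⟩

/-- Functions `f'` for which the values `∂f(xⱼ)` exist and satisfy the balance condition. -/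
def balancedInward [Fintype E] : Submodule ℂ Γ.L2 where
  carrier := {f' | ∃ t, Γ.HasBoundaryValues f' t ∧ Γ.IsBalancedAtVertices (inward t)}
  zero_mem' := ⟨0, .zero, by rw [inward_zero]; exact .zero⟩
  add_mem' := fun ⟨_, hf, hs⟩ ⟨_, hg, ht⟩ =>
    ⟨_, hf.add hg, by rw [inward_add]; exact hs.add ht⟩
  smul_mem' := fun c _ ⟨_, hf, hs⟩ => ⟨_, hf.smul c, by rw [inward_smul]; exact hs.smul c⟩

/-- The operator `f ↦ -f''` with domain the functions `f` in `W₂²(Γ \ V)` such that `f` lies in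
`P` and `f'` lies in `Q`. -/
def laplacian (P Q : Submodule ℂ Γ.L2) : Γ.L2 →ₗ.[ℂ] Γ.L2 where
  domain := Γ.W2 ⊓ (P ⊓ (Q.comap Γ.weakDeriv).map Γ.W1.subtype)
  toFun := - (Γ.ddx₂.toFun ∘ₗ Submodule.inclusion inf_le_left)

/-- The standard (Kirchhoff) Laplacian: `f ↦ -f''` on the functions in `W₂²(Γ \ V)` with
continuous values and balanced inward derivatives at each vertex. -/
def standardLaplacian [Fintype E] : Γ.L2 →ₗ.[ℂ] Γ.L2 :=
  Γ.laplacian Γ.continuousValues Γ.balancedInward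

/-- The anti-standard (anti-Kirchhoff) Laplacian: `f ↦ -f''` on the functions in `W₂²(Γ \ V)`
with balanced values and continuous inward derivatives at each vertex. -/
def antiStandardLaplacian [Fintype E] : Γ.L2 →ₗ.[ℂ] Γ.L2 :=
  Γ.laplacian Γ.balancedValues Γ.continuousInward

/-- The momentum operator `D f = (1/i) f'` on the functions in `W₂¹(Γ \ V)` that satisfy the
continuity condition at each vertex. -/
def momentum : Γ.L2 →ₗ.[ℂ] Γ.L2 where
  domain := Γ.W1 ⊓ Γ.continuousValues
  toFun := (1 / Complex.I) • (Γ.weakDeriv ∘ₗ Submodule.inclusion inf_le_left)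

end MetricGraph

end

/-! ### Absolutely continuous and weakly differentiable functions on an interval. -/

section IntervalAnalysis

variable {a b : ℝ}

/-! Everything rests on Green's identity (`inner_add_inner_eq_sum`): for weakly differentiable `f`,
`g`, the sum `⟪f', g⟫ + ⟪f, g'⟫` is a pairing of the values of `f` at the endpoints with the signed
values of `g`. It holds because Sobolev functions have absolutely continuous representatives, by the
du Bois-Reymond lemma.

Testing with functions supported inside an edge shows that the adjoint of `D` also acts as `(1/i)
d/dx`. Testing with functions equal to one at a single vertex and zero at the others shows that its
domain is cut out by the balance condition on signed values (`mem_graph_adjoint_momentum_iff`).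
Composing the two first-order operators gives `-f''`, with one vertex condition on `f` and the other
on `f'` (`laplacian_eq_prod`). For `D*D` these are the standard conditions, on any finite graph.

For `DD*` the signs sit on `f` instead of `f'`. In the bipartite case all endpoints at a vertex have
the same orientation, so the sign is constant there and affects neither condition; this gives the
anti-standard Laplacian.

The spectral claim is algebraic: `T` maps `ker (ST - μ)` to `ker (TS - μ)`, `S` maps back, and both
composites are multiplication by `μ ≠ 0`. -/

theorem IntervalIntegrable.absolutelyContinuousOnInterval_primitive {E : Type*}
    [NormedAddCommGroup E] [NormedSpace ℝ E] {f : ℝ → E} (hf : IntervalIntegrable f volume a b) :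
    AbsolutelyContinuousOnInterval (fun x => ∫ t in a..x, f t) a b := by
  -- Increments of the primitive are dominated by those of the real primitive of `‖f‖`, which is
  -- absolutely continuous.
  have h := hf.norm.absolutelyContinuousOnInterval_intervalIntegral
    (Set.left_mem_uIcc : a ∈ Set.uIcc a b)
  refine squeeze_zero' (Eventually.of_forall fun I => Finset.sum_nonneg fun _ _ => dist_nonneg)
    ?_ h
  filter_upwards [mem_inf_of_right (mem_principal_self _)] with I hI
  refine Finset.sum_le_sum fun i hi => ?_
  obtain ⟨h₁, h₂⟩ := hI.1 i hi
  have ha₁ := Set.uIcc_subset_uIcc_left h₁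
  have ha₂ := Set.uIcc_subset_uIcc_left h₂
  rw [dist_eq_norm, dist_eq_norm, Real.norm_eq_abs,
    intervalIntegral.integral_interval_sub_left (hf.mono_set ha₁) (hf.mono_set ha₂),
    intervalIntegral.integral_interval_sub_left (hf.norm.mono_set ha₁) (hf.norm.mono_set ha₂)]
  exact intervalIntegral.norm_integral_le_abs_integral_norm

theorem AbsolutelyContinuousOnInterval.conj {f : ℝ → ℂ}
    (hf : AbsolutelyContinuousOnInterval f a b) :
    AbsolutelyContinuousOnInterval (fun x => starRingEnd ℂ (f x)) a b := by
  unfold AbsolutelyContinuousOnInterval at hf ⊢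
  simpa only [Complex.dist_conj_conj] using hf

/-- Integration by parts for absolutely continuous complex-valued functions. -/
theorem AbsolutelyContinuousOnInterval.integral_add_eq_mul_sub_mul {F G f g : ℝ → ℂ}
    (hF : AbsolutelyContinuousOnInterval F a b) (hG : AbsolutelyContinuousOnInterval G a b)
    (hFf : ∀ᵐ x, x ∈ Set.uIcc a b → HasDerivAt F (f x) x)
    (hGg : ∀ᵐ x, x ∈ Set.uIcc a b → HasDerivAt G (g x) x)
    (hf : IntervalIntegrable f volume a b) (hg : IntervalIntegrable g volume a b) :
    ∫ x in a..b, (f x * G x + F x * g x) = F b * G b - F a * G a := by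
  have hi : IntervalIntegrable (fun x => f x * G x + F x * g x) volume a b :=
    (hf.mul_continuousOn hG.continuousOn).add (hg.continuousOn_mul hF.continuousOn)
  -- `F G` minus the primitive of its derivative is absolutely continuous with derivative zero
  -- almost everywhere, hence constant; its values at `a` and `b` are then compared.
  obtain ⟨C, hC⟩ := AbsolutelyContinuousOnInterval.const_of_ae_hasDerivAt_zero
    ((hF.smul hG).sub hi.absolutelyContinuousOnInterval_primitive) (by
      filter_upwards [hFf, hGg, hi.ae_hasDerivAt_integral] with x h₁ h₂ h₃ hx
      simpa using ((h₁ hx).mul (h₂ hx)).sub (h₃ hx a Set.left_mem_uIcc))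
  have := (hC b Set.right_mem_uIcc).trans (hC a Set.left_mem_uIcc).symm
  simp only [Pi.sub_apply, smul_eq_mul, Pi.mul_apply,
    intervalIntegral.integral_same, sub_zero] at this
  rw [← this]; ring

/-- A compactly supported smooth function on an open interval with vanishing integral is the
derivative of another one. -/
theorem exists_contDiff_deriv_eq {φ : ℝ → ℝ} (hφ : ContDiff ℝ ∞ φ)
    (hc : HasCompactSupport φ) (hs : tsupport φ ⊆ Set.Ioo a b) (h0 : ∫ x, φ x = 0) :
    ∃ ψ : ℝ → ℝ, ContDiff ℝ ∞ ψ ∧ HasCompactSupport ψ ∧ tsupport ψ ⊆ Set.Ioo a b ∧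
      deriv ψ = φ := by
  rcases (tsupport φ).eq_empty_or_nonempty with he | hne
  · refine ⟨0, contDiff_const, HasCompactSupport.zero, by simp, ?_⟩
    rw [tsupport_eq_empty_iff] at he
    rw [he]; ext; simp
  obtain ⟨c, hcm, hcl⟩ := hc.isCompact.exists_isLeast hne
  obtain ⟨d, hdm, hdl⟩ := hc.isCompact.exists_isGreatest hne
  have hφc : ∀ x, x < c → φ x = 0 := fun x hx =>
    image_eq_zero_of_notMem_tsupport fun h => hx.not_ge (hcl h)
  have hsupp : Function.support φ ⊆ Set.Icc c d := fun x hx =>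
    ⟨hcl (subset_tsupport _ hx), hdl (subset_tsupport _ hx)⟩
  -- The primitive vanishes to the left of the support of `φ` trivially, and to its right because
  -- the total integral is zero.
  set ψ : ℝ → ℝ := fun x => ∫ t in a..x, φ t with hψ
  have hder : ∀ x, HasDerivAt ψ (φ x) x := fun x =>
    hφ.continuous.integral_hasStrictDerivAt a x |>.hasDerivAt
  have hd : deriv ψ = φ := funext fun x => (hder x).deriv
  have hac := (hs hcm).1
  have hdb := (hs hdm).2
  have hψs : Function.support ψ ⊆ Set.Icc c d := by
    intro x hx
    by_contra hx'
    apply hx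
    rw [Set.mem_Icc, not_and_or, not_le, not_le] at hx'
    rcases hx' with hx' | hx'
    · refine intervalIntegral.integral_zero_ae (Eventually.of_forall fun t ht => hφc t ?_)
      rcases Set.mem_uIoc.1 ht with ht | ht <;> linarith [ht.2]
    · have had : a < x := (hs hdm).1.trans hx'
      rw [hψ]
      change ∫ t in a..x, φ t = 0
      rw [intervalIntegral.integral_of_le had.le,
        setIntegral_eq_integral_of_forall_compl_eq_zero, h0]
      intro t ht
      by_contra h
      have := hsupp h
      exact ht ⟨hac.trans_le this.1, this.2.trans hx'.le⟩
  have hts : tsupport ψ ⊆ Set.Icc c d := closure_minimal hψs isClosed_Icc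
  refine ⟨ψ, ?_, HasCompactSupport.intro (K := Set.Icc c d) isCompact_Icc fun x hx => ?_, hts.trans fun x hx =>
    ⟨hac.trans_le hx.1, hx.2.trans_lt hdb⟩, hd⟩
  · rw [contDiff_infty_iff_deriv, hd]
    exact ⟨fun x => (hder x).differentiableAt, hφ⟩
  · by_contra h
    exact hx (hψs h)

theorem setIntegral_Icc_smul_eq_integral {φ : ℝ → ℝ} (hs : tsupport φ ⊆ Set.Ioo a b)
    (h : ℝ → ℂ) : ∫ x in Set.Icc a b, φ x • h x = ∫ x, φ x • h x :=
  setIntegral_eq_integral_of_forall_compl_eq_zero fun x hx => by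
    rw [image_eq_zero_of_notMem_tsupport fun hx' => hx (Set.Ioo_subset_Icc_self (hs hx')),
      zero_smul]

theorem MeasureTheory.IntegrableOn.smul_of_hasCompactSupport {h : ℝ → ℂ} {s : Set ℝ}
    (hh : IntegrableOn h s) {φ : ℝ → ℝ} (hφ : Continuous φ) (hc : HasCompactSupport φ) :
    IntegrableOn (fun x => φ x • h x) s := by
  obtain ⟨C, hC⟩ := hc.exists_bound_of_continuous hφ
  exact Integrable.bdd_smul hh C hφ.aestronglyMeasurable (Eventually.of_forall hC)

/-- The fundamental lemma of the calculus of variations on the open interval; the two endpoints form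
a null set. -/
theorem ae_restrict_Icc_eq_zero_of_forall_integral {h : ℝ → ℂ} (hh : IntegrableOn h (Set.Icc a b))
    (h0 : ∀ φ : ℝ → ℝ, ContDiff ℝ ∞ φ → HasCompactSupport φ → tsupport φ ⊆ Set.Ioo a b →
      ∫ x in Set.Icc a b, φ x • h x = 0) :
    ∀ᵐ x ∂volume.restrict (Set.Icc a b), h x = 0 := by
  have := isOpen_Ioo.ae_eq_zero_of_integral_contDiff_smul_eq_zero
    (hh.mono_set Set.Ioo_subset_Icc_self).locallyIntegrableOn fun φ hφ hc hs => by
      rw [← setIntegral_Icc_smul_eq_integral hs]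
      exact h0 φ hφ hc hs
  rw [← Measure.restrict_congr_set Ioo_ae_eq_Icc, ae_restrict_iff' measurableSet_Ioo]
  exact this

/-- The **du Bois-Reymond lemma**: an integrable function with vanishing weak derivative is almost
everywhere constant. -/
theorem exists_ae_eq_const_of_integral_deriv_smul_eq_zero (hab : a < b) {h : ℝ → ℂ}
    (hh : IntegrableOn h (Set.Icc a b))
    (h0 : ∀ φ : ℝ → ℝ, ContDiff ℝ ∞ φ → HasCompactSupport φ → tsupport φ ⊆ Set.Ioo a b →
      ∫ x in Set.Icc a b, deriv φ x • h x = 0) :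
    ∃ c, ∀ᵐ x ∂volume.restrict (Set.Icc a b), h x = c := by
  -- A bump of unit mass around the midpoint, with radii small enough to stay inside the interval.
  -- The constant will be the mean of `h` against it.
  let B : ContDiffBump ((a + b) / 2) := ⟨(b - a) / 8, (b - a) / 4, by linarith, by linarith⟩
  set η : ℝ → ℝ := B.normed volume with hη
  have hηs : tsupport η ⊆ Set.Ioo a b := by
    rw [hη, B.tsupport_normed_eq, Real.closedBall_eq_Icc]
    exact Set.Icc_subset_Ioo (by change a < _ - (b - a) / 4; linarith)
      (by change _ + (b - a) / 4 < b; linarith)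
  have hηd : ContDiff ℝ ∞ η := B.contDiff_normed
  have hηc : HasCompactSupport η := B.hasCompactSupport_normed
  have hη1 : ∫ x, η x = 1 := B.integral_normed
  set c := ∫ x in Set.Icc a b, η x • h x with hcdef
  refine ⟨c, ?_⟩
  have hconst : IntegrableOn (fun _ : ℝ => c) (Set.Icc a b) := integrableOn_const (by simp)
  have key : ∀ᵐ x ∂volume.restrict (Set.Icc a b), h x - c = 0 := by
    refine ae_restrict_Icc_eq_zero_of_forall_integral (hh.sub hconst) fun φ hφ hc hs => ?_
    -- `φ - m η` has mean zero, so it is the derivative of a test function and is annihilated by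
    -- `h`.
    set m := ∫ x, φ x with hm
    have hφi : Integrable φ := hφ.continuous.integrable_of_hasCompactSupport hc
    have hηi : Integrable η := hηd.continuous.integrable_of_hasCompactSupport hηc
    have hts : tsupport (fun x => φ x - m * η x) ⊆ Set.Ioo a b :=
      (tsupport_sub _ _).trans (Set.union_subset hs
        ((tsupport_mul_subset_right).trans hηs))
    obtain ⟨ψ, hψd, hψc, hψs, hψ⟩ := exists_contDiff_deriv_eq (a := a) (b := b)
      (φ := fun x => φ x - m * η x) (hφ.sub (contDiff_const.mul hηd)) (hc.sub hηc.mul_left) hts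
      (by rw [integral_sub hφi (hηi.const_mul m), integral_const_mul, hη1]; simp [hm])
    have h1 := h0 ψ hψd hψc hψs
    have hI1 := hh.smul_of_hasCompactSupport hφ.continuous hc
    have hI2 := hh.smul_of_hasCompactSupport hηd.continuous hηc
    simp_rw [hψ, sub_smul, mul_smul] at h1
    rw [integral_sub hI1 (Integrable.fun_smul m hI2), integral_smul, ← hcdef] at h1
    simp_rw [smul_sub]
    rw [integral_sub hI1 (hconst.smul_of_hasCompactSupport hφ.continuous hc),
      setIntegral_Icc_smul_eq_integral hs (fun _ => c), integral_smul_const, ← hm]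
    exact h1
  filter_upwards [key] with x hx using sub_eq_zero.1 hx

/-- Integration by parts without boundary terms, since `φ` vanishes at both ends. -/
theorem AbsolutelyContinuousOnInterval.integral_deriv_smul_eq_neg (hab : a ≤ b) {F f : ℝ → ℂ}
    (hF : AbsolutelyContinuousOnInterval F a b)
    (hFf : ∀ᵐ x, x ∈ Set.uIcc a b → HasDerivAt F (f x) x)
    (hf : IntegrableOn f (Set.Icc a b)) {φ : ℝ → ℝ} (hφ : ContDiff ℝ ∞ φ)
    (hc : HasCompactSupport φ) (hs : tsupport φ ⊆ Set.Ioo a b) :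
    ∫ x in Set.Icc a b, deriv φ x • F x = - ∫ x in Set.Icc a b, φ x • f x := by
  have hφ' : Continuous (deriv φ) := hφ.continuous_deriv (by simp)
  have hder : ∀ x, HasDerivAt (fun x => (φ x : ℂ)) ((deriv φ x : ℝ) : ℂ) x := fun x =>
    ((hφ.differentiable (by simp)) x).hasDerivAt.ofReal_comp
  have hac : AbsolutelyContinuousOnInterval (fun x => (φ x : ℂ)) a b :=
    ContDiffOn.absolutelyContinuousOnInterval
      (Complex.ofRealCLM.contDiff.comp (hφ.of_le (by simp))).contDiffOn
  have hz : ∀ x, x ∉ Set.Ioo a b → φ x = 0 := fun x hx =>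
    image_eq_zero_of_notMem_tsupport fun h => hx (hs h)
  have h := hac.integral_add_eq_mul_sub_mul hF (Eventually.of_forall fun x _ => hder x) hFf
    ((Complex.continuous_ofReal.comp hφ').intervalIntegrable _ _)
    ((intervalIntegrable_iff_integrableOn_Icc_of_le hab).2 hf)
  rw [hz a (by simp), hz b (by simp), intervalIntegral.integral_of_le hab,
    ← integral_Icc_eq_integral_Ioc] at h
  have hFi : IntegrableOn F (Set.Icc a b) :=
    (Set.uIcc_of_le hab ▸ hF.continuousOn).integrableOn_Icc
  have h' := integral_add (hFi.smul_of_hasCompactSupport hφ' hc.deriv)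
    (hf.smul_of_hasCompactSupport hφ.continuous hc)
  simp only [Complex.real_smul] at h' ⊢
  rw [h'] at h
  simp only [Complex.ofReal_zero, zero_mul, sub_zero] at h
  exact eq_neg_of_add_eq_zero_left h

end IntervalAnalysis

/-! ### Representatives, boundary values and Green's identity on the graph. -/

namespace MetricGraph

variable {V E : Type*} {Γ : MetricGraph V E} {e : E}

theorem uIcc_edge (e : E) :
    Set.uIcc (Γ.left e) (Γ.right e) = Set.Icc (Γ.left e) (Γ.right e) :=
  Set.uIcc_of_le (Γ.left_lt_right e).le

theorem integrableOn_edge (u : Lp ℂ 2 (Γ.edgeMeasure e)) :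
    IntegrableOn u (Set.Icc (Γ.left e) (Γ.right e)) :=
  (Lp.memLp u).integrable (by norm_num)

theorem intervalIntegrable_edge (u : Lp ℂ 2 (Γ.edgeMeasure e)) :
    IntervalIntegrable u volume (Γ.left e) (Γ.right e) :=
  (intervalIntegrable_iff_integrableOn_Icc_of_le (Γ.left_lt_right e).le).2 (integrableOn_edge u)

theorem integral_edgeMeasure (h : ℝ → ℂ) :
    ∫ x, h x ∂(Γ.edgeMeasure e) = ∫ x in Γ.left e..Γ.right e, h x := by
  rw [intervalIntegral.integral_of_le (Γ.left_lt_right e).le, ← integral_Icc_eq_integral_Ioc]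
  rfl

theorem point_mem_Icc (j : E × Bool) :
    Γ.point j ∈ Set.Icc (Γ.left j.1) (Γ.right j.1) := by
  have := (Γ.left_lt_right j.1).le
  unfold point; split <;> simp [this]

/-- Each neighbourhood of an endpoint meets its edge in a set of positive measure. This makes
boundary values unique even though functions are almost everywhere classes. -/
instance nhds_point_inf_ae_neBot (j : E × Bool) :
    (𝓝 (Γ.point j) ⊓ ae (Γ.edgeMeasure j.1)).NeBot := by
  rw [inf_neBot_iff]
  intro s hs t ht
  by_contra hst
  rw [Set.not_nonempty_iff_eq_empty, ← Set.disjoint_iff_inter_eq_empty] at hst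
  have h0 : Γ.edgeMeasure j.1 s = 0 :=
    measure_mono_null hst.subset_compl_right (mem_ae_iff.1 ht)
  obtain ⟨U, hUs, hU, hpU⟩ := mem_nhds_iff.1 hs
  have hcl : Γ.point j ∈ closure (Set.Ioo (Γ.left j.1) (Γ.right j.1)) := by
    rw [closure_Ioo (Γ.left_lt_right j.1).ne]; exact point_mem_Icc j
  have hne := mem_closure_iff.1 hcl U hU hpU
  refine ((hU.inter isOpen_Ioo).measure_pos volume hne).ne' ?_
  refine measure_mono_null (Set.inter_subset_inter hUs Set.Ioo_subset_Icc_self) ?_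
  rw [edgeMeasure, Measure.restrict_apply' measurableSet_Icc] at h0
  exact h0

theorem HasBoundaryValues.unique {f : Γ.L2} {s t : E × Bool → ℂ}
    (hs : Γ.HasBoundaryValues f s) (ht : Γ.HasBoundaryValues f t) : s = t :=
  funext fun j => tendsto_nhds_unique (hs j) (ht j)

/-- `F` is an absolutely continuous representative on the edge `e` of the class `u`, with
derivative `u'` almost everywhere. -/
structure IsRepresentative (F : ℝ → ℂ) (u u' : Lp ℂ 2 (Γ.edgeMeasure e)) : Prop where
  absolutelyContinuous : AbsolutelyContinuousOnInterval F (Γ.left e) (Γ.right e)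
  ae_eq : u =ᵐ[Γ.edgeMeasure e] F
  ae_hasDerivAt : ∀ᵐ x, x ∈ Set.uIcc (Γ.left e) (Γ.right e) → HasDerivAt F (u' x) x

/-- The class minus the primitive of its weak derivative has weak derivative zero, so by du
Bois-Reymond it is a constant. -/
theorem HasWeakDeriv.exists_isRepresentative {f f' : Γ.L2} (h : Γ.HasWeakDeriv f f') (e : E) :
    ∃ F, IsRepresentative F (f e) (f' e) := by
  have hab := Γ.left_lt_right e
  set G : ℝ → ℂ := fun x => ∫ t in Γ.left e..x, f' e t with hG
  have hGac : AbsolutelyContinuousOnInterval G (Γ.left e) (Γ.right e) :=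
    (intervalIntegrable_edge (f' e)).absolutelyContinuousOnInterval_primitive
  have hGd : ∀ᵐ x, x ∈ Set.uIcc (Γ.left e) (Γ.right e) → HasDerivAt G (f' e x) x := by
    filter_upwards [(intervalIntegrable_edge (f' e)).ae_hasDerivAt_integral] with x hx hxm
    exact hx hxm _ Set.left_mem_uIcc
  have hGi : IntegrableOn G (Set.Icc (Γ.left e) (Γ.right e)) :=
    (uIcc_edge (Γ := Γ) e ▸ hGac.continuousOn).integrableOn_Icc
  obtain ⟨c, hc⟩ := exists_ae_eq_const_of_integral_deriv_smul_eq_zero hab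
    ((integrableOn_edge (f e)).sub hGi) fun φ hφ hcs hs => by
      have hφ' : Continuous (deriv φ) := hφ.continuous_deriv (by simp)
      simp only [Pi.sub_apply, smul_sub]
      rw [integral_sub ((integrableOn_edge (f e)).smul_of_hasCompactSupport hφ' hcs.deriv)
        (hGi.smul_of_hasCompactSupport hφ' hcs.deriv),
        hGac.integral_deriv_smul_eq_neg hab.le hGd (integrableOn_edge (f' e)) hφ hcs hs]
      exact sub_eq_zero.2 (h e φ hφ hcs hs)
  refine ⟨fun x => G x + c, ?_, ?_, ?_⟩
  · exact hGac.add (ContDiffOn.absolutelyContinuousOnInterval contDiffOn_const)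
  · filter_upwards [hc] with x hx
    rw [← hx]; simp
  · filter_upwards [hGd] with x hx hxm using (hx hxm).add_const c

theorem HasWeakDeriv.of_isRepresentative {f f' : Γ.L2} {F : E → ℝ → ℂ}
    (h : ∀ e, IsRepresentative (F e) (f e) (f' e)) : Γ.HasWeakDeriv f f' := by
  intro e φ hφ hc hs
  have := (h e).absolutelyContinuous.integral_deriv_smul_eq_neg (Γ.left_lt_right e).le
    (h e).ae_hasDerivAt (integrableOn_edge (f' e)) hφ hc hs
  refine Eq.trans (integral_congr_ae ?_) this
  filter_upwards [(h e).ae_eq] with x hx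
  rw [hx]

theorem IsRepresentative.tendsto {F : ℝ → ℂ} {u u' : Lp ℂ 2 (Γ.edgeMeasure e)}
    (h : IsRepresentative F u u') {p : ℝ} (hp : p ∈ Set.Icc (Γ.left e) (Γ.right e)) :
    Tendsto u (𝓝 p ⊓ ae (Γ.edgeMeasure e)) (𝓝 (F p)) := by
  have hF := h.absolutelyContinuous.continuousOn
  rw [uIcc_edge] at hF
  refine Tendsto.congr' (h.ae_eq.filter_mono inf_le_right).symm ((hF p hp).mono_left ?_)
  refine inf_le_inf_left _ (le_principal_iff.2 ?_)
  exact self_mem_ae_restrict measurableSet_Icc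

theorem hasBoundaryValues_of_isRepresentative {f f' : Γ.L2} {F : E → ℝ → ℂ}
    (h : ∀ e, IsRepresentative (F e) (f e) (f' e)) :
    Γ.HasBoundaryValues f fun j => F j.1 (Γ.point j) :=
  fun j => (h j.1).tendsto (point_mem_Icc j)

theorem HasWeakDeriv.exists_hasBoundaryValues {f f' : Γ.L2} (h : Γ.HasWeakDeriv f f') :
    ∃ t, Γ.HasBoundaryValues f t := by
  choose F hF using h.exists_isRepresentative
  exact ⟨_, hasBoundaryValues_of_isRepresentative hF⟩

/-- Integration by parts on one edge. -/
theorem IsRepresentative.inner_add_inner {F G : ℝ → ℂ} {u u' v v' : Lp ℂ 2 (Γ.edgeMeasure e)}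
    (hF : IsRepresentative F u u') (hG : IsRepresentative G v v') :
    ⟪u', v⟫_ℂ + ⟪u, v'⟫_ℂ = starRingEnd ℂ (F (Γ.right e)) * G (Γ.right e) -
      starRingEnd ℂ (F (Γ.left e)) * G (Γ.left e) := by
  have hu' : IntervalIntegrable (fun x => starRingEnd ℂ (u' x)) volume (Γ.left e) (Γ.right e) := by
    rw [intervalIntegrable_iff_integrableOn_Icc_of_le (Γ.left_lt_right e).le]
    exact Complex.conjCLE.toContinuousLinearMap.integrable_comp (integrableOn_edge u')
  rw [← hF.absolutelyContinuous.conj.integral_add_eq_mul_sub_mul hG.absolutelyContinuous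
    (f := fun x => starRingEnd ℂ (u' x)) (g := v') ?_ hG.ae_hasDerivAt hu'
    (intervalIntegrable_edge v'), ← integral_edgeMeasure, L2.inner_def, L2.inner_def,
    ← integral_add (L2.integrable_inner u' v) (L2.integrable_inner u v')]
  · refine integral_congr_ae ?_
    filter_upwards [hF.ae_eq, hG.ae_eq] with x h₁ h₂
    simp only [RCLike.inner_apply, h₁, h₂]
    ring
  · filter_upwards [hF.ae_hasDerivAt] with x hx hxm
    exact (hx hxm).star

/-- Green's identity. Right endpoints contribute with a plus and left ones with a minus, opposite to
the convention of `inward`; hence the overall sign. -/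
theorem inner_add_inner_eq_sum [Fintype E] {f f' g g' : Γ.L2} {s t : E × Bool → ℂ}
    (hf : Γ.HasWeakDeriv f f') (hg : Γ.HasWeakDeriv g g')
    (hs : Γ.HasBoundaryValues f s) (ht : Γ.HasBoundaryValues g t) :
    ⟪f', g⟫_ℂ + ⟪f, g'⟫_ℂ = - ∑ j, starRingEnd ℂ (s j) * inward t j := by
  choose F hF using hf.exists_isRepresentative
  choose G hG using hg.exists_isRepresentative
  rw [hs.unique (hasBoundaryValues_of_isRepresentative hF),
    ht.unique (hasBoundaryValues_of_isRepresentative hG), PiLp.inner_apply, PiLp.inner_apply,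
    ← Finset.sum_add_distrib, Fintype.sum_prod_type, ← Finset.sum_neg_distrib]
  refine Finset.sum_congr rfl fun e _ => ?_
  rw [(hF e).inner_add_inner (hG e)]
  simp [inward, point]
  ring

theorem memLp_edgeMeasure {u : ℝ → ℂ} (hu : Continuous u) : MemLp u 2 (Γ.edgeMeasure e) := by
  obtain ⟨C, hC⟩ := isCompact_Icc.exists_bound_of_continuousOn
    (hu.continuousOn (s := Set.Icc (Γ.left e) (Γ.right e)))
  exact MemLp.of_bound hu.aestronglyMeasurable C (ae_restrict_of_forall_mem measurableSet_Icc hC)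

/-- The class in `L₂(Γ)` of a family of continuous functions on the edges. -/
noncomputable def ofContinuous (Γ : MetricGraph V E) (u : E → ℝ → ℂ) (hu : ∀ e, Continuous (u e)) :
    Γ.L2 :=
  WithLp.toLp 2 fun e => (memLp_edgeMeasure (hu e)).toLp (u e)

theorem ofContinuous_ae_eq {u : E → ℝ → ℂ} (hu : ∀ e, Continuous (u e)) (e : E) :
    Γ.ofContinuous u hu e =ᵐ[Γ.edgeMeasure e] u e :=
  (memLp_edgeMeasure (hu e)).coeFn_toLp

theorem isRepresentative_ofContinuous {u u' : E → ℝ → ℂ} (hu : ∀ e x, HasDerivAt (u e) (u' e x) x)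
    (hc : ∀ e, Continuous (u e)) (hc' : ∀ e, Continuous (u' e)) (e : E) :
    IsRepresentative (u e) (Γ.ofContinuous u hc e) (Γ.ofContinuous u' hc' e) where
  absolutelyContinuous := by
    refine ContDiffOn.absolutelyContinuousOnInterval (ContDiff.contDiffOn ?_)
    rw [contDiff_one_iff_deriv, show deriv (u e) = u' e from funext fun x => (hu e x).deriv]
    exact ⟨fun x => (hu e x).differentiableAt, hc' e⟩
  ae_eq := ofContinuous_ae_eq hc e
  ae_hasDerivAt := by
    filter_upwards [(ae_restrict_iff' measurableSet_Icc).1 (ofContinuous_ae_eq hc' e)] with x hx hxm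
    rw [hx (uIcc_edge (Γ := Γ) e ▸ hxm)]
    exact hu e x

end MetricGraph

/-! ### Graphs and eigenspaces of products of unbounded operators. -/

namespace UnboundedOperator

variable {H : Type*} [AddCommGroup H] [Module ℂ H]

/-- The natural domain is exactly what makes the graph of a product the composition of relations.
Operator identities are then checked on graphs, domain and action at once. -/
theorem mem_graph_prod_iff {S T : H →ₗ.[ℂ] H} {x y : H} :
    (x, y) ∈ (prod S T).graph ↔ ∃ z, (x, z) ∈ T.graph ∧ (z, y) ∈ S.graph := by
  simp only [LinearPMap.mem_graph_iff]
  constructor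
  · rintro ⟨⟨_, w, hw, rfl⟩, rfl, rfl⟩
    exact ⟨T w, ⟨w, rfl, rfl⟩, ⟨T w, hw⟩, rfl, rfl⟩
  · rintro ⟨_, ⟨w, rfl, rfl⟩, z, hz, rfl⟩
    refine ⟨⟨w, w, ?_, rfl⟩, rfl, ?_⟩
    · change T w ∈ S.domain
      rw [← hz]; exact z.2
    · change S _ = S _
      congr 1
      exact Subtype.ext hz.symm

theorem mem_eigenspace_iff {T : H →ₗ.[ℂ] H} {μ : ℂ} {x : H} :
    x ∈ eigenspace T μ ↔ (x, μ • x) ∈ T.graph := by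
  simp only [eigenspace, Submodule.mem_map, LinearMap.mem_ker, LinearMap.sub_apply,
    LinearMap.smul_apply, LinearPMap.mem_graph_iff, sub_eq_zero]
  constructor
  · rintro ⟨y, hy, rfl⟩
    exact ⟨y, rfl, hy⟩
  · rintro ⟨y, rfl, hy⟩
    exact ⟨y, hy, rfl⟩

theorem isEigenvalue_iff {T : H →ₗ.[ℂ] H} {μ : ℂ} :
    IsEigenvalue T μ ↔ eigenspace T μ ≠ ⊥ := by
  rw [Submodule.ne_bot_iff]
  constructor
  · rintro ⟨x, hx, h⟩
    exact ⟨x, mem_eigenspace_iff.2 ((LinearPMap.mem_graph_iff _).2 ⟨x, rfl, h⟩), hx⟩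
  · rintro ⟨x, hx, h⟩
    obtain ⟨y, rfl, hy⟩ := (LinearPMap.mem_graph_iff _).1 (mem_eigenspace_iff.1 hx)
    exact ⟨y, h, hy⟩

theorem eigenspace_prod_le_domain {S T : H →ₗ.[ℂ] H} {μ : ℂ} :
    eigenspace (prod S T) μ ≤ T.domain := fun _ hx => by
  obtain ⟨z, hz, -⟩ := mem_graph_prod_iff.1 (mem_eigenspace_iff.1 hx)
  exact LinearPMap.mem_domain_of_mem_graph hz

/-- `T` maps `ker (S T - μ)` to `ker (T S - μ)`. -/
noncomputable def eigenspaceMap (S T : H →ₗ.[ℂ] H) (μ : ℂ) :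
    eigenspace (prod S T) μ →ₗ[ℂ] eigenspace (prod T S) μ :=
  (T.toFun ∘ₗ Submodule.inclusion eigenspace_prod_le_domain).codRestrict _ fun x => by
    obtain ⟨z, hz, hz'⟩ := mem_graph_prod_iff.1 (mem_eigenspace_iff.1 x.2)
    have hx : z = T ⟨x, eigenspace_prod_le_domain x.2⟩ :=
      LinearPMap.mem_graph_snd_inj T hz (T.mem_graph ⟨x, eigenspace_prod_le_domain x.2⟩) rfl
    subst hx
    -- With `z = T x` and `S z = μ x`, the intermediate vector is `μ x`, and `T (μ x) = μ z`.
    refine mem_eigenspace_iff.2 (mem_graph_prod_iff.2 ⟨_, hz', ?_⟩)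
    exact T.graph.smul_mem μ hz

theorem mem_graph_eigenspaceMap {S T : H →ₗ.[ℂ] H} {μ : ℂ} (x : eigenspace (prod S T) μ) :
    ((x : H), (eigenspaceMap S T μ x : H)) ∈ T.graph :=
  T.mem_graph ⟨x, eigenspace_prod_le_domain x.2⟩

theorem eigenspaceMap_eigenspaceMap {S T : H →ₗ.[ℂ] H} {μ : ℂ}
    (x : eigenspace (prod S T) μ) : eigenspaceMap T S μ (eigenspaceMap S T μ x) = μ • x := by
  obtain ⟨z, hz, hz'⟩ := mem_graph_prod_iff.1 (mem_eigenspace_iff.1 x.2)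
  have h : z = eigenspaceMap S T μ x :=
    LinearPMap.mem_graph_snd_inj T hz (mem_graph_eigenspaceMap x) rfl
  subst h
  exact Subtype.ext (LinearPMap.mem_graph_snd_inj S (mem_graph_eigenspaceMap _) hz' rfl)

/-- For `μ ≠ 0` the eigenspaces of `S T` and `T S` for `μ` are isomorphic. -/
noncomputable def eigenspaceEquiv (S T : H →ₗ.[ℂ] H) {μ : ℂ} (hμ : μ ≠ 0) :
    eigenspace (prod S T) μ ≃ₗ[ℂ] eigenspace (prod T S) μ :=
  LinearEquiv.ofLinearMap (eigenspaceMap S T μ) (μ⁻¹ • eigenspaceMap T S μ)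
    (LinearMap.ext fun x => by
      simp [eigenspaceMap_eigenspaceMap, smul_smul, hμ])
    (LinearMap.ext fun x => by
      simp [eigenspaceMap_eigenspaceMap, smul_smul, hμ])

theorem multiplicity_prod_comm (S T : H →ₗ.[ℂ] H) {μ : ℂ} (hμ : μ ≠ 0) :
    multiplicity (prod S T) μ = multiplicity (prod T S) μ :=
  (eigenspaceEquiv S T hμ).rank_eq

theorem isEigenvalue_prod_comm (S T : H →ₗ.[ℂ] H) {μ : ℂ} (hμ : μ ≠ 0) :
    IsEigenvalue (prod S T) μ ↔ IsEigenvalue (prod T S) μ := by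
  rw [isEigenvalue_iff, isEigenvalue_iff, ← Submodule.nontrivial_iff_ne_bot,
    ← Submodule.nontrivial_iff_ne_bot]
  exact (eigenspaceEquiv S T hμ).toEquiv.nontrivial_congr

end UnboundedOperator

/-! ### The momentum operator and its adjoint. -/

namespace MetricGraph

variable {V E : Type*} {Γ : MetricGraph V E}

theorem weakDeriv_eq {f f' : Γ.L2} (h : Γ.HasWeakDeriv f f') : Γ.weakDeriv ⟨f, f', h⟩ = f' :=
  (Γ.hasWeakDeriv_weakDeriv ⟨f, f', h⟩).unique h

theorem mem_graph_ddx_iff {f g : Γ.L2} : (f, g) ∈ Γ.ddx.graph ↔ Γ.HasWeakDeriv f g := by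
  rw [LinearPMap.mem_graph_iff]
  constructor
  · rintro ⟨f, rfl, rfl⟩
    exact Γ.hasWeakDeriv_weakDeriv f
  · exact fun h => ⟨⟨f, g, h⟩, rfl, weakDeriv_eq h⟩

theorem mem_graph_momentum_iff {f g : Γ.L2} : (f, g) ∈ Γ.momentum.graph ↔
    ∃ f', Γ.HasWeakDeriv f f' ∧ f ∈ Γ.continuousValues ∧ g = (1 / Complex.I) • f' := by
  rw [LinearPMap.mem_graph_iff]
  constructor
  · rintro ⟨f, rfl, rfl⟩
    exact ⟨_, Γ.hasWeakDeriv_weakDeriv ⟨f, f.2.1⟩, f.2.2, rfl⟩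
  · rintro ⟨f', h, hf, rfl⟩
    exact ⟨⟨f, ⟨f', h⟩, hf⟩, rfl, congrArg ((1 / Complex.I) • ·) (weakDeriv_eq h)⟩

theorem mem_graph_laplacian_iff {P Q : Submodule ℂ Γ.L2} {f g : Γ.L2} :
    (f, g) ∈ (Γ.laplacian P Q).graph ↔ ∃ f' f'', Γ.HasWeakDeriv f f' ∧ Γ.HasWeakDeriv f' f'' ∧
      f ∈ P ∧ f' ∈ Q ∧ g = -f'' := by
  have key : ∀ {f g}, (f, g) ∈ Γ.ddx₂.graph ↔
      ∃ f', Γ.HasWeakDeriv f f' ∧ Γ.HasWeakDeriv f' g := by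
    intro f g
    rw [ddx₂, UnboundedOperator.mem_graph_prod_iff]
    simp only [mem_graph_ddx_iff]
  rw [LinearPMap.mem_graph_iff]
  constructor
  · rintro ⟨⟨f, h₂, hP, w, hQ, rfl⟩, rfl, rfl⟩
    obtain ⟨f', h, h'⟩ := key.1 (Γ.ddx₂.mem_graph ⟨w, h₂⟩)
    refine ⟨f', _, h, h', hP, ?_, rfl⟩
    rw [← (Γ.hasWeakDeriv_weakDeriv w).unique h]
    exact hQ
  · rintro ⟨f', f'', h, h', hP, hQ, rfl⟩
    have hg := key.2 ⟨f', h, h'⟩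
    refine ⟨⟨f, LinearPMap.mem_domain_of_mem_graph hg, hP, ⟨f, f', h⟩, ?_, rfl⟩, rfl, ?_⟩
    · change Γ.weakDeriv _ ∈ Q
      rwa [weakDeriv_eq h]
    · refine congrArg Neg.neg (LinearPMap.mem_graph_snd_inj Γ.ddx₂ (Γ.ddx₂.mem_graph _) hg rfl)

/-- Arbitrary boundary values are attained by a function in `W₂¹(Γ \ V)`. -/
theorem exists_hasWeakDeriv_hasBoundaryValues (Γ : MetricGraph V E) (s : E × Bool → ℂ) :
    ∃ u u' : Γ.L2, Γ.HasWeakDeriv u u' ∧ Γ.HasBoundaryValues u s := by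
  -- The slope of the affine interpolation between the prescribed values on the edge.
  let k (e : E) : ℂ := (s (e, true) - s (e, false)) / ((Γ.right e : ℂ) - Γ.left e)
  have hrep := isRepresentative_ofContinuous (Γ := Γ)
    (u := fun e x => s (e, false) + ((x : ℂ) - Γ.left e) * k e) (u' := fun e _ => k e) (by
      intro e x
      have := ((((hasDerivAt_id x).ofReal_comp).sub_const (Γ.left e : ℂ)).mul_const
        (k e)).const_add (s (e, false))
      simpa using this) (fun e => by fun_prop) (fun e => continuous_const)
  refine ⟨_, _, .of_isRepresentative hrep, ?_⟩
  convert hasBoundaryValues_of_isRepresentative hrep using 1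
  funext ⟨e, d⟩
  have hne : (Γ.right e : ℂ) - Γ.left e ≠ 0 := by
    rw [sub_ne_zero]; exact_mod_cast (Γ.left_lt_right e).ne'
  cases d
  · simp [point]
  · simp only [point, k, if_true]
    field_simp
    ring

section Fintype

variable [Fintype E]

theorem inner_ofContinuous {u : E → ℝ → ℂ} (hu : ∀ e, Continuous (u e)) (w : Γ.L2) :
    ⟪Γ.ofContinuous u hu, w⟫_ℂ =
      ∑ e, ∫ x, starRingEnd ℂ (u e x) * w e x ∂(Γ.edgeMeasure e) := by
  rw [PiLp.inner_apply]
  refine Finset.sum_congr rfl fun e _ => ?_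
  rw [L2.inner_def]
  refine integral_congr_ae ?_
  filter_upwards [ofContinuous_ae_eq hu e] with x hx
  rw [hx, RCLike.inner_apply, mul_comm]

open Classical in
/-- A test function on one edge, extended by zero to the other edges, is in the domain of the
momentum operator. -/
theorem exists_testFunction (e : E) {φ : ℝ → ℝ} (hφ : ContDiff ℝ ∞ φ)
    (hs : tsupport φ ⊆ Set.Ioo (Γ.left e) (Γ.right e)) :
    ∃ u u' : Γ.L2, Γ.HasWeakDeriv u u' ∧ u ∈ Γ.continuousValues ∧ ∀ w : Γ.L2,
      ⟪u, w⟫_ℂ = ∫ x, φ x • w e x ∂(Γ.edgeMeasure e) ∧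
      ⟪u', w⟫_ℂ = ∫ x, deriv φ x • w e x ∂(Γ.edgeMeasure e) := by
  let ext (ψ : ℝ → ℝ) : E → ℝ → ℂ := fun e' x => if e' = e then (ψ x : ℂ) else 0
  have hcont : ∀ {ψ : ℝ → ℝ}, Continuous ψ → ∀ e', Continuous (ext ψ e') := by
    intro ψ hψ e'
    by_cases h : e' = e
    · simp only [ext, h, if_true]; fun_prop
    · simp only [ext, h, if_false]; fun_prop
  have hinner : ∀ {ψ : ℝ → ℝ} (hψ : Continuous ψ) (w : Γ.L2),
      ⟪Γ.ofContinuous (ext ψ) (hcont hψ), w⟫_ℂ = ∫ x, ψ x • w e x ∂(Γ.edgeMeasure e) := by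
    intro ψ hψ w
    rw [inner_ofContinuous, Finset.sum_eq_single e]
    · simp [ext]
    · intro e' _ h
      simp [ext, h]
    · simp
  have hφ' : Continuous (deriv φ) := hφ.continuous_deriv (by simp)
  have hrep := isRepresentative_ofContinuous (Γ := Γ) (u := ext φ) (u' := ext (deriv φ)) (by
    intro e' x
    by_cases h : e' = e
    · simp only [ext, h, if_true]
      exact ((hφ.differentiable (by simp)) x).hasDerivAt.ofReal_comp
    · simp only [ext, h, if_false]
      exact hasDerivAt_const x 0) (hcont hφ.continuous) (hcont hφ')
  refine ⟨_, _, .of_isRepresentative hrep,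
    ⟨_, hasBoundaryValues_of_isRepresentative hrep, ?_⟩,
    fun w => ⟨hinner hφ.continuous w, hinner hφ' w⟩⟩
  -- All boundary values vanish, since `φ` is supported in the open edge; continuity at the vertices
  -- is then trivial.
  have hz : ∀ j : E × Bool, ext φ j.1 (Γ.point j) = 0 := by
    intro j
    by_cases h : j.1 = e
    · simp only [ext, h, if_true, Complex.ofReal_eq_zero]
      refine image_eq_zero_of_notMem_tsupport fun hx => ?_
      have := hs hx
      rw [← h] at this
      unfold point at this
      split at this <;> simp at this
    · simp only [ext, h, if_false]
  intro i j _
  simp only [hz]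

/-- A vector orthogonal to the domain integrates to zero against every test function on every edge.
-/
theorem dense_domain_momentum (Γ : MetricGraph V E) :
    Dense (Γ.momentum.domain : Set Γ.L2) := by
  rw [Submodule.dense_iff_topologicalClosure_eq_top, Submodule.topologicalClosure_eq_top_iff,
    Submodule.eq_bot_iff]
  intro w hw
  ext1 e
  apply Lp.ext
  refine EventuallyEq.trans ?_ (Lp.coeFn_zero ℂ 2 _).symm
  refine ae_restrict_Icc_eq_zero_of_forall_integral (integrableOn_edge (w e))
    fun φ hφ _ hs => ?_
  obtain ⟨u, u', h, hu, hi⟩ := exists_testFunction (Γ := Γ) e hφ hs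
  exact (hi w).1.symm.trans (hw u ⟨⟨u', h⟩, hu⟩)

/-- Group the endpoints by vertex: `s` is constant on each group and factors out of a vanishing sum.
-/
theorem sum_star_mul_eq_zero {s t : E × Bool → ℂ} (hs : Γ.IsContinuousAtVertices s)
    (ht : Γ.IsBalancedAtVertices t) : ∑ j, starRingEnd ℂ (s j) * t j = 0 := by
  classical
  rw [← Finset.sum_fiberwise_of_maps_to (g := Γ.vertex) (t := Finset.univ.image Γ.vertex)
    fun j _ => Finset.mem_image_of_mem _ (Finset.mem_univ j)]
  refine Finset.sum_eq_zero fun v hv => ?_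
  obtain ⟨i, -, rfl⟩ := Finset.mem_image.1 hv
  rw [← mul_zero (starRingEnd ℂ (s i)), ← ht (Γ.vertex i), Finset.mul_sum]
  refine Finset.sum_congr (by congr) fun j hj => ?_
  rw [hs j i (Finset.mem_filter.1 hj).2]

theorem mem_graph_adjoint_momentum_iff {f g : Γ.L2} : (f, g) ∈ Γ.momentum.adjoint.graph ↔
    ∃ f', Γ.HasWeakDeriv f f' ∧ f ∈ Γ.balancedInward ∧ g = (1 / Complex.I) • f' := by
  rw [LinearPMap.adjoint_graph_eq_graph_adjoint Γ.dense_domain_momentum, Submodule.mem_adjoint_iff]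
  have hI : starRingEnd ℂ (1 / Complex.I) = Complex.I := by simp
  constructor
  · intro H
    have H' : ∀ {u u' : Γ.L2}, Γ.HasWeakDeriv u u' → u ∈ Γ.continuousValues →
        Complex.I * ⟪u', f⟫_ℂ = ⟪u, g⟫_ℂ := by
      intro u u' h hu
      have := H u _ (mem_graph_momentum_iff.2 ⟨u', h, hu, rfl⟩)
      rwa [inner_smul_left, hI, sub_eq_zero] at this
    -- Test functions inside a single edge suffice to identify the weak derivative.
    have hf : Γ.HasWeakDeriv f (Complex.I • g) := by
      intro e φ hφ _ hs
      obtain ⟨u, u', h, hu, hi⟩ := exists_testFunction (Γ := Γ) e hφ hs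
      rw [← (hi f).2, ← (hi _).1, inner_smul_right, ← H' h hu, ← mul_assoc, Complex.I_mul_I]
      ring
    refine ⟨_, hf, ?_, by rw [smul_smul]; simp⟩
    obtain ⟨t, ht⟩ := hf.exists_hasBoundaryValues
    refine ⟨t, ht, fun v => ?_⟩
    classical
    -- The indicator of the vertex `v` is continuous at vertices, so `u` lies in the domain of `D`.
    -- The adjoint relation kills the left side of Green's identity, and the right side is minus the
    -- signed sum at `v`.
    obtain ⟨u, u', h, hu⟩ := Γ.exists_hasWeakDeriv_hasBoundaryValues
      fun j => if Γ.vertex j = v then 1 else 0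
    have hibp := inner_add_inner_eq_sum h hf hu ht
    rw [inner_smul_right, ← H' h ⟨_, hu, fun i j hij => by simp only [hij]⟩, ← mul_assoc,
      Complex.I_mul_I, neg_one_mul, add_neg_cancel, eq_comm, neg_eq_zero] at hibp
    rw [Finset.sum_filter]
    refine Eq.trans (Finset.sum_congr rfl fun j _ => ?_) hibp
    split_ifs <;> simp
  · rintro ⟨f', hf, ⟨t, ht, hb⟩, rfl⟩ u _ hu
    obtain ⟨u', h, ⟨s, hs, hc⟩, rfl⟩ := mem_graph_momentum_iff.1 hu
    have hibp := inner_add_inner_eq_sum h hf hs ht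
    rw [sum_star_mul_eq_zero hc hb, neg_zero] at hibp
    rw [inner_smul_left, inner_smul_right, hI, eq_neg_of_add_eq_zero_left hibp]
    simp

end Fintype

/-! ### Bipartite orientation makes signs constant at each vertex. -/

section Bipartite

variable {V₁ V₂ : Set V} (hΓ : Γ.IsBipartiteOriented V₁ V₂)

include hΓ

/-- A vertex containing both a left and a right endpoint would lie in both `V₁` and `V₂`. -/
theorem IsBipartiteOriented.snd_eq {i j : E × Bool} (h : Γ.vertex i = Γ.vertex j) :
    i.2 = j.2 := by
  obtain ⟨e, c⟩ := i
  obtain ⟨e', d⟩ := j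
  have hdis := Set.disjoint_left.1 hΓ.disjoint
  cases c <;> cases d <;> first | rfl | exfalso
  · exact hdis (hΓ.left_mem e) (h ▸ hΓ.right_mem e')
  · exact hdis (hΓ.left_mem e') (h ▸ hΓ.right_mem e)

theorem IsBipartiteOriented.isContinuousAtVertices_inward_iff {t : E × Bool → ℂ} :
    Γ.IsContinuousAtVertices (inward t) ↔ Γ.IsContinuousAtVertices t := by
  refine forall_congr' fun i => forall_congr' fun j => forall_congr' fun h => ?_
  simp only [inward, hΓ.snd_eq h]
  split_ifs <;> simp

theorem IsBipartiteOriented.continuousInward_eq : Γ.continuousInward = Γ.continuousValues := by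
  ext f
  exact exists_congr fun t => and_congr_right fun _ => hΓ.isContinuousAtVertices_inward_iff

theorem IsBipartiteOriented.isBalancedAtVertices_inward_iff [Fintype E] {t : E × Bool → ℂ} :
    Γ.IsBalancedAtVertices (inward t) ↔ Γ.IsBalancedAtVertices t := by
  classical
  refine forall_congr' fun v => ?_
  -- An endpoint at the vertex is needed to read off the common sign.
  obtain ⟨i, rfl⟩ := Γ.vertex_surjective v
  have : ∑ j with Γ.vertex j = Γ.vertex i, inward t j =
      (if i.2 then -1 else 1) * ∑ j with Γ.vertex j = Γ.vertex i, t j := by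
    rw [Finset.mul_sum]
    refine Finset.sum_congr rfl fun j hj => ?_
    rw [inward, hΓ.snd_eq (Finset.mem_filter.1 hj).2]
    split_ifs <;> simp
  convert_to ∑ j with Γ.vertex j = Γ.vertex i, inward t j = 0 ↔
    ∑ j with Γ.vertex j = Γ.vertex i, t j = 0
  rw [this]
  split_ifs <;> simp

theorem IsBipartiteOriented.balancedInward_eq [Fintype E] :
    Γ.balancedInward = Γ.balancedValues := by
  ext f
  exact exists_congr fun t => and_congr_right fun _ => hΓ.isBalancedAtVertices_inward_iff

end Bipartite

/-! ### Factorization of the Laplacians. -/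

theorem HasWeakDeriv.of_smul {f g : Γ.L2} {c : ℂ} (hc : c ≠ 0) (h : Γ.HasWeakDeriv (c • f) g) :
    Γ.HasWeakDeriv f (c⁻¹ • g) := by
  simpa [smul_smul, hc] using h.smul c⁻¹

/-- One computation serves both factorizations: `(1/i)² = -1`, and `Q`, being a subspace, contains
`(1/i) f'` exactly when it contains `f'`. -/
theorem laplacian_eq_prod {P Q : Submodule ℂ Γ.L2} {S T : Γ.L2 →ₗ.[ℂ] Γ.L2}
    (hT : ∀ {f g}, (f, g) ∈ T.graph ↔
      ∃ f', Γ.HasWeakDeriv f f' ∧ f ∈ P ∧ g = (1 / Complex.I) • f')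
    (hS : ∀ {f g}, (f, g) ∈ S.graph ↔
      ∃ f', Γ.HasWeakDeriv f f' ∧ f ∈ Q ∧ g = (1 / Complex.I) • f') :
    Γ.laplacian P Q = UnboundedOperator.prod S T := by
  have hI : (1 / Complex.I : ℂ) ≠ 0 := by simp
  apply LinearPMap.eq_of_eq_graph
  ext ⟨f, g⟩
  simp only [mem_graph_laplacian_iff, UnboundedOperator.mem_graph_prod_iff, hT, hS]
  constructor
  · rintro ⟨f', f'', h, h', hP, hQ, rfl⟩
    refine ⟨_, ⟨f', h, hP, rfl⟩, _, h'.smul _, Q.smul_mem _ hQ, ?_⟩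
    rw [smul_smul]; simp
  · rintro ⟨_, ⟨f', h, hP, rfl⟩, f'', h', hQ, rfl⟩
    refine ⟨f', _, h, h'.of_smul hI, hP, (Q.smul_mem_iff hI).1 hQ, ?_⟩
    simp

theorem standardLaplacian_eq_prod [Fintype E] (Γ : MetricGraph V E) :
    Γ.standardLaplacian = UnboundedOperator.prod Γ.momentum.adjoint Γ.momentum :=
  laplacian_eq_prod mem_graph_momentum_iff mem_graph_adjoint_momentum_iff

theorem IsBipartiteOriented.antiStandardLaplacian_eq_prod [Fintype E] {V₁ V₂ : Set V}
    (hΓ : Γ.IsBipartiteOriented V₁ V₂) :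
    Γ.antiStandardLaplacian = UnboundedOperator.prod Γ.momentum Γ.momentum.adjoint := by
  -- The sign is dropped from the condition on `f'` and inserted into the condition on `f`, to match
  -- the domains of `D` and its adjoint.
  rw [antiStandardLaplacian, hΓ.continuousInward_eq, ← hΓ.balancedInward_eq]
  exact laplacian_eq_prod mem_graph_adjoint_momentum_iff mem_graph_momentum_iff

end MetricGraph

theorem lemma3p1 {V E : Type*} [Fintype E] (Γ : MetricGraph V E) (V₁ V₂ : Set V)
    (hΓ : Γ.IsBipartiteOriented V₁ V₂) :
    Dense (Γ.momentum.domain : Set Γ.L2) ∧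
    Γ.standardLaplacian = UnboundedOperator.prod Γ.momentum.adjoint Γ.momentum ∧
    Γ.antiStandardLaplacian = UnboundedOperator.prod Γ.momentum Γ.momentum.adjoint ∧
    ∀ μ : ℝ, 0 < μ →
      (UnboundedOperator.IsEigenvalue Γ.standardLaplacian μ ↔
        UnboundedOperator.IsEigenvalue Γ.antiStandardLaplacian μ) ∧
      UnboundedOperator.multiplicity Γ.standardLaplacian μ =
        UnboundedOperator.multiplicity Γ.antiStandardLaplacian μ := by
  refine ⟨Γ.dense_domain_momentum, Γ.standardLaplacian_eq_prod,
    hΓ.antiStandardLaplacian_eq_prod, fun μ hμ => ?_⟩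
  have hμ' : (μ : ℂ) ≠ 0 := Complex.ofReal_ne_zero.2 hμ.ne'
  rw [Γ.standardLaplacian_eq_prod, hΓ.antiStandardLaplacian_eq_prod]
  exact ⟨UnboundedOperator.isEigenvalue_prod_comm _ _ hμ',
    UnboundedOperator.multiplicity_prod_comm _ _ hμ'⟩
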